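/- Every positive odd integer $p$ (in particular every odd prime) can be written as $p=a_1^2+a_2^2+a_3^2+a_4^2$ with $a_1,a_2,a_3,a_4\in\mathbb{Z}$ and $a_1\in\{1,2\}$. For such $a_1,\dots,a_4$, the quaternion $P=a_1+a_2i+a_3j+a_4k$ is a Lipschitz integer (all four coordinates in $\mathbb{Z}$), hence a Hurwitz integer (the coordinates are either all in $\mathbb{Z}$ or all in $\mathbb{Z}+\tfrac12$), with norm $N(P)=P\overline{P}=p$ and with real part $\mathrm{Re}(P)=a_1$ a power of $2$ (namely $2^0$ or $2^1$). -/

import Mathlib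

open scoped Quaternion in
/-- The Lipschitz integers: the real quaternions `a + bi + cj + dk` with `a, b, c, d ∈ ℤ`. -/
def lipschitzIntegers : Subring (Quaternion ℝ) where
  carrier := {q | ∃ a b c d : ℤ, q.re = a ∧ q.imI = b ∧ q.imJ = c ∧ q.imK = d}
  zero_mem' := ⟨0, 0, 0, 0, by simp, by simp, by simp, by simp⟩
  one_mem' := ⟨1, 0, 0, 0, by simp, by simp, by simp, by simp⟩
  add_mem' := by
    rintro p q ⟨a, b, c, d, h1, h2, h3, h4⟩ ⟨x, y, z, w, k1, k2, k3, k4⟩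
    refine ⟨a + x, b + y, c + z, d + w, ?_, ?_, ?_, ?_⟩ <;>
        simp [*]
  neg_mem' := by
    rintro p ⟨a, b, c, d, h1, h2, h3, h4⟩
    refine ⟨-a, -b, -c, -d, ?_, ?_, ?_, ?_⟩ <;>
        simp [*]
  mul_mem' := by
    rintro p q ⟨a, b, c, d, h1, h2, h3, h4⟩ ⟨x, y, z, w, k1, k2, k3, k4⟩
    refine ⟨a * x - b * y - c * z - d * w, a * y + b * x + c * w - d * z,
      a * z - b * w + c * x + d * y, a * w + b * z - c * y + d * x, ?_, ?_, ?_, ?_⟩ <;>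
        simp [*]

open scoped Quaternion in
/-- The Hurwitz integers: the real quaternions `a + bi + cj + dk` with either
`a, b, c, d ∈ ℤ` or `a, b, c, d ∈ ℤ + 1/2`. -/
def hurwitzIntegers : Subring (Quaternion ℝ) where
  carrier := {q | (∃ a b c d : ℤ, q.re = a ∧ q.imI = b ∧ q.imJ = c ∧ q.imK = d) ∨
    ∃ a b c d : ℤ, q.re = a + 1 / 2 ∧ q.imI = b + 1 / 2 ∧ q.imJ = c + 1 / 2 ∧ q.imK = d + 1 / 2}
  zero_mem' := Or.inl ⟨0, 0, 0, 0, by simp, by simp, by simp, by simp⟩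
  one_mem' := Or.inl ⟨1, 0, 0, 0, by simp, by simp, by simp, by simp⟩
  add_mem' := by
    rintro p q (⟨a, b, c, d, h1, h2, h3, h4⟩ | ⟨a, b, c, d, h1, h2, h3, h4⟩)
      (⟨x, y, z, w, k1, k2, k3, k4⟩ | ⟨x, y, z, w, k1, k2, k3, k4⟩)
    · refine Or.inl ⟨a + x, b + y, c + z, d + w, ?_, ?_, ?_, ?_⟩ <;>
        simp [*]
    · refine Or.inr ⟨a + x, b + y, c + z, d + w, ?_, ?_, ?_, ?_⟩ <;>
        simp [*] <;> ring
    · refine Or.inr ⟨a + x, b + y, c + z, d + w, ?_, ?_, ?_, ?_⟩ <;>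
        simp [*] <;> ring
    · refine Or.inl ⟨a + x + 1, b + y + 1, c + z + 1, d + w + 1, ?_, ?_, ?_, ?_⟩ <;>
        simp [*] <;> ring
  neg_mem' := by
    rintro p (⟨a, b, c, d, h1, h2, h3, h4⟩ | ⟨a, b, c, d, h1, h2, h3, h4⟩)
    · refine Or.inl ⟨-a, -b, -c, -d, ?_, ?_, ?_, ?_⟩ <;>
        simp [*]
    · refine Or.inr ⟨-a - 1, -b - 1, -c - 1, -d - 1, ?_, ?_, ?_, ?_⟩ <;>
        simp [*] <;> ring
  mul_mem' := by
    rintro p q (⟨a, b, c, d, h1, h2, h3, h4⟩ | ⟨a, b, c, d, h1, h2, h3, h4⟩)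
      (⟨x, y, z, w, k1, k2, k3, k4⟩ | ⟨x, y, z, w, k1, k2, k3, k4⟩)
    · refine Or.inl ⟨a * x - b * y - c * z - d * w, a * y + b * x + c * w - d * z,
        a * z - b * w + c * x + d * y, a * w + b * z - c * y + d * x, ?_, ?_, ?_, ?_⟩ <;>
        simp [*]
    · obtain ⟨n, hn | hn⟩ := Int.even_or_odd' (a + b + c + d)
      · obtain rfl : a = 2 * n - b - c - d := by omega
        refine Or.inl ⟨(2 * n - b - c - d) * x - b * y - c * z - d * w + n - b - c - d,
          (2 * n - b - c - d) * y + b * x + c * w - d * z + n - d,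
          (2 * n - b - c - d) * z - b * w + c * x + d * y + n - b,
          (2 * n - b - c - d) * w + b * z - c * y + d * x + n - c,
          ?_, ?_, ?_, ?_⟩ <;>
        simp [*] <;> ring
      · obtain rfl : a = 2 * n + 1 - b - c - d := by omega
        refine Or.inr ⟨(2 * n + 1 - b - c - d) * x - b * y - c * z - d * w + n - b - c - d,
          (2 * n + 1 - b - c - d) * y + b * x + c * w - d * z + n - d,
          (2 * n + 1 - b - c - d) * z - b * w + c * x + d * y + n - b,
          (2 * n + 1 - b - c - d) * w + b * z - c * y + d * x + n - c,
          ?_, ?_, ?_, ?_⟩ <;>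
        simp [*] <;> ring
    · obtain ⟨n, hn | hn⟩ := Int.even_or_odd' (x + y + z + w)
      · obtain rfl : x = 2 * n - y - z - w := by omega
        refine Or.inl ⟨a * (2 * n - y - z - w) - b * y - c * z - d * w + n - y - z - w,
          a * y + b * (2 * n - y - z - w) + c * w - d * z + n - z,
          a * z - b * w + c * (2 * n - y - z - w) + d * y + n - w,
          a * w + b * z - c * y + d * (2 * n - y - z - w) + n - y,
          ?_, ?_, ?_, ?_⟩ <;>
        simp [*] <;> ring
      · obtain rfl : x = 2 * n + 1 - y - z - w := by omega
        refine Or.inr ⟨a * (2 * n + 1 - y - z - w) - b * y - c * z - d * w + n - y - z - w,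
          a * y + b * (2 * n + 1 - y - z - w) + c * w - d * z + n - z,
          a * z - b * w + c * (2 * n + 1 - y - z - w) + d * y + n - w,
          a * w + b * z - c * y + d * (2 * n + 1 - y - z - w) + n - y,
          ?_, ?_, ?_, ?_⟩ <;>
        simp [*] <;> ring
    · obtain ⟨n, hn | hn⟩ := Int.even_or_odd' (a + b + c + d + x + y + z + w)
      · obtain rfl : a = 2 * n - b - c - d - x - y - z - w := by omega
        refine Or.inr ⟨(2 * n - b - c - d - x - y - z - w) * x - b * y - c * z - d * w
            + n - b - c - d - y - z - w - 1,
          (2 * n - b - c - d - x - y - z - w) * y + b * x + c * w - d * z + n - d - z,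
          (2 * n - b - c - d - x - y - z - w) * z - b * w + c * x + d * y + n - b - w,
          (2 * n - b - c - d - x - y - z - w) * w + b * z - c * y + d * x + n - c - y,
          ?_, ?_, ?_, ?_⟩ <;>
        simp [*] <;> ring
      · obtain rfl : a = 2 * n + 1 - b - c - d - x - y - z - w := by omega
        refine Or.inl ⟨(2 * n + 1 - b - c - d - x - y - z - w) * x - b * y - c * z - d * w
            + n - b - c - d - y - z - w,
          (2 * n + 1 - b - c - d - x - y - z - w) * y + b * x + c * w - d * z + n - d - z + 1,
          (2 * n + 1 - b - c - d - x - y - z - w) * z - b * w + c * x + d * y + n - b - w + 1,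
          (2 * n + 1 - b - c - d - x - y - z - w) * w + b * z - c * y + d * x + n - c - y + 1,
          ?_, ?_, ?_, ?_⟩ <;>
        simp [*] <;> ring

/-! Subtracting 1 from `p ≡ 3 (mod 4)`, or 4 from `p ≡ 1 (mod 4)` with `p > 1`, leaves `n ≡ 2` or `1
(mod 4)`, a sum of three squares by Dirichlet's argument. Primes in progressions and reciprocity
yield `D` and `r` with `D * n - 1 ∣ r ^ 2 + D`; this builds a positive definite ternary form of
determinant 1 taking the value `n`, and reduction turns such a form into a sum of three squares. -/

theorem exists_two_mul_abs_add_mul_le (m t : ℤ) (hm : 0 < m) :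
    ∃ k : ℤ, 2 * |t + k * m| ≤ m := by
  -- The quotient is `t / m` rounded to a nearest integer.
  refine ⟨-((2 * t + m) / (2 * m)), ?_⟩
  have h1 := Int.emod_add_mul_ediv (2 * t + m) (2 * m)
  have h2 := Int.emod_nonneg (2 * t + m) (b := 2 * m) (by omega)
  have h3 := Int.emod_lt_of_pos (2 * t + m) (b := 2 * m) (by omega)
  have h4 : 2 * |t + -((2 * t + m) / (2 * m)) * m| = |2 * (t + -((2 * t + m) / (2 * m)) * m)| := by
    rw [abs_mul]; rfl
  rw [h4, abs_le]
  constructor <;> nlinarith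

/-- Every value of a positive definite integral ternary quadratic form of determinant `1` is a sum
of three squares. -/
theorem ternary_form_value_eq_sum_three_sq (a b c d e f : ℤ) (ha : 0 < a)
    (hg : 0 < a * b - f ^ 2)
    (hdet : a * b * c + 2 * d * e * f - a * d ^ 2 - b * e ^ 2 - c * f ^ 2 = 1) (x y z : ℤ) :
    ∃ u v w : ℤ, a * x ^ 2 + b * y ^ 2 + c * z ^ 2 + 2 * d * y * z + 2 * e * x * z + 2 * f * x * y =
      u ^ 2 + v ^ 2 + w ^ 2 := by
  -- Completing the square, `a` times the form is `(a x + f y + e z) ^ 2` plus a binary form in `y,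
  -- z` of determinant `a` and leading coefficient `g = a b - f ^ 2`. Each reduction lowers `(a, g)`
  -- lexicographically.
  have hG : (a * b - f ^ 2) * (a * c - e ^ 2) - (a * d - e * f) ^ 2 = a := by
    linear_combination a * hdet
  by_cases hcase : 4 * a < 3 * (a * b - f ^ 2) ^ 2
  · -- reduce the binary form in `y, z`: shear `z`, then swap `y` and `z`
    obtain ⟨k, hk⟩ := exists_two_mul_abs_add_mul_le (a * b - f ^ 2) (a * d - e * f) hg
    have hk2 : 4 * (a * d - e * f + k * (a * b - f ^ 2)) ^ 2 ≤ (a * b - f ^ 2) ^ 2 := by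
      rw [← sq_abs (a * d - e * f + k * (a * b - f ^ 2))]
      nlinarith [abs_nonneg (a * d - e * f + k * (a * b - f ^ 2))]
    have hG' : (a * b - f ^ 2) * (a * (c + 2 * k * d + k ^ 2 * b) - (e + k * f) ^ 2) =
        a + (a * d - e * f + k * (a * b - f ^ 2)) ^ 2 := by
      linear_combination hG
    have hpos : 0 < a * (c + 2 * k * d + k ^ 2 * b) - (e + k * f) ^ 2 := by
      refine pos_of_mul_pos_right (a := a * b - f ^ 2) ?_ hg.le
      rw [hG']; positivity
    have hlt : a * (c + 2 * k * d + k ^ 2 * b) - (e + k * f) ^ 2 < a * b - f ^ 2 := by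
      refine lt_of_mul_lt_mul_left (a := a * b - f ^ 2) ?_ hg.le
      rw [hG']; nlinarith
    obtain ⟨u, v, w, h⟩ := ternary_form_value_eq_sum_three_sq a (c + 2 * k * d + k ^ 2 * b) b
      (d + k * b) f (e + k * f) ha hpos (by linear_combination hdet) x z (y - k * z)
    exact ⟨u, v, w, by rw [← h]; ring⟩
  · by_cases ha1 : a = 1
    · subst ha1
      have hg1 : 1 * b - f ^ 2 = 1 := by nlinarith
      obtain rfl : b = f ^ 2 + 1 := by linarith
      refine ⟨x + f * y + e * z, y + (d - e * f) * z, z, ?_⟩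
      linear_combination z ^ 2 * hG
    · obtain ⟨k, hk⟩ := exists_two_mul_abs_add_mul_le a f ha
      have hk2 : 4 * (f + k * a) ^ 2 ≤ a ^ 2 := by
        rw [← sq_abs (f + k * a)]
        nlinarith [abs_nonneg (f + k * a)]
      have hg' : a * (b + 2 * k * f + k ^ 2 * a) = (a * b - f ^ 2) + (f + k * a) ^ 2 := by ring
      have hpos : 0 < b + 2 * k * f + k ^ 2 * a := by
        refine pos_of_mul_pos_right (a := a) ?_ ha.le
        rw [hg']; positivity
      have hlt : b + 2 * k * f + k ^ 2 * a < a := by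
        -- Otherwise `3 a ^ 2 ≤ 4 g`; with `3 g ^ 2 ≤ 4 a` this gives `27 a ^ 3 ≤ 64`, so `a < 2`.
        by_contra! hle
        have h1 : 3 * a ^ 2 ≤ 4 * (a * b - f ^ 2) := by nlinarith
        have h2 : (3 * a ^ 2) ^ 2 ≤ (4 * (a * b - f ^ 2)) ^ 2 :=
          pow_le_pow_left₀ (by positivity) h1 2
        have ha2 : 2 ≤ a := by omega
        have h3 : 8 ≤ a ^ 3 := by
          calc (8 : ℤ) = 2 ^ 3 := by norm_num
            _ ≤ a ^ 3 := pow_le_pow_left₀ (by norm_num) ha2 3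
        nlinarith [mul_le_mul_of_nonneg_left h3 ha.le]
      obtain ⟨u, v, w, h⟩ := ternary_form_value_eq_sum_three_sq (b + 2 * k * f + k ^ 2 * a) a c
        e (d + k * e) (f + k * a) hpos (by linear_combination hg) (by linear_combination hdet)
        y (x - k * y) z
      exact ⟨u, v, w, by rw [← h]; ring⟩
termination_by (a.toNat, (a * b - f ^ 2).toNat)
decreasing_by
  · exact Prod.Lex.right _ ((Int.toNat_lt_toNat hg).2 hlt)
  · exact Prod.Lex.left _ _ ((Int.toNat_lt_toNat ha).2 hlt)

/-- The form with matrix `[a, r, 1; r, D n - 1, 0; 1, 0, n]` has leading minor `D` and determinant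
`D n - (D n - 1) = 1`. -/
theorem sum_three_sq_of_dvd_sq_add {n D r : ℤ} (hD : 0 < D) (hn : 0 < D * n - 1)
    (h : D * n - 1 ∣ r ^ 2 + D) : ∃ u v w : ℤ, n = u ^ 2 + v ^ 2 + w ^ 2 := by
  obtain ⟨a, ha⟩ := h
  have hapos : 0 < a := by
    refine pos_of_mul_pos_right (a := D * n - 1) ?_ hn.le
    rw [← ha]; positivity
  obtain ⟨u, v, w, h⟩ := ternary_form_value_eq_sum_three_sq a (D * n - 1) n 0 1 r hapos
    (by linarith) (by linear_combination (-n) * ha) 0 0 1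
  exact ⟨u, v, w, by rw [← h]; ring⟩

open NumberTheorySymbols in
theorem jacobiSym_neg_eq_of_mod_four {D P : ℕ} (hD : Odd D) (hP : P % 4 = 1 ∨ D % 4 = 3 ∧ P % 4 = 3) :
    J(-(D : ℤ) | P) = J(P | D) := by
  rw [neg_eq_neg_one_mul, jacobiSym.mul_left]
  rcases hP with hP | ⟨hD4, hP⟩
  · rw [jacobiSym.at_neg_one (Nat.odd_iff.2 (by omega)), ZMod.χ₄_nat_one_mod_four hP, one_mul,
      jacobiSym.quadratic_reciprocity_one_mod_four' hD hP]
  · rw [jacobiSym.at_neg_one (Nat.odd_iff.2 (by omega)), ZMod.χ₄_nat_three_mod_four hP,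
      jacobiSym.quadratic_reciprocity_three_mod_four hD4 hP, neg_one_mul, neg_neg]

open NumberTheorySymbols in
theorem exists_dvd_sq_add_of_jacobiSym_eq_one {D P : ℕ} (hP : P.Prime) (h : J(-(D : ℤ) | P) = 1) :
    ∃ r : ℤ, (P : ℤ) ∣ r ^ 2 + D := by
  have := Fact.mk hP
  obtain ⟨s, hs⟩ := ZMod.isSquare_of_jacobiSym_eq_one h
  obtain ⟨r, rfl⟩ := ZMod.intCast_surjective s
  refine ⟨r, (ZMod.intCast_zmod_eq_zero_iff_dvd _ P).1 ?_⟩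
  push_cast at hs ⊢
  linear_combination -hs

theorem exists_prime_eq_add_mul {a q : ℕ} (hq : q ≠ 0) (h : a.Coprime q) :
    ∃ P j : ℕ, P.Prime ∧ P = a + q * j := by
  obtain ⟨P, hlt, hP, hmod⟩ := Nat.forall_exists_prime_gt_and_modEq a hq h
  obtain ⟨j, hj⟩ := (Nat.modEq_iff_dvd' hlt.le).1 hmod.symm
  exact ⟨P, j, hP, by omega⟩

/-- With `D = 4 j + 1` and `P = D n - 1` prime, `J(-D | P) = J(P | D) = J(-1 | D) = 1`. -/
theorem sum_three_sq_of_mod_four_eq_two (t : ℕ) :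
    ∃ u v w : ℤ, ((4 * t + 2 : ℕ) : ℤ) = u ^ 2 + v ^ 2 + w ^ 2 := by
  have hcop : (4 * t + 1).Coprime (4 * (4 * t + 2)) := by
    refine Nat.Coprime.mul_right ?_ ?_
    · simp [Nat.coprime_mul_left_add_left]
    · simp [show 4 * t + 2 = 4 * t + 1 + 1 by ring]
  obtain ⟨P, j, hP, hj⟩ := exists_prime_eq_add_mul (by omega) hcop
  have hPZ : (P : ℤ) = ((4 * j + 1 : ℕ) : ℤ) * (4 * t + 2 : ℕ) - 1 := by
    rw [hj]; push_cast; ring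
  have hP4 : P % 4 = 1 := by rw [hj, mul_assoc]; omega
  have hDodd : Odd (4 * j + 1) := Nat.odd_iff.2 (by omega)
  have hJ : jacobiSym (-((4 * j + 1 : ℕ) : ℤ)) P = 1 := by
    rw [jacobiSym_neg_eq_of_mod_four hDodd (Or.inl hP4), hPZ,
      jacobiSym.mod_left' (a₂ := -1) (by simp [sub_eq_add_neg, Int.add_emod]),
      jacobiSym.at_neg_one hDodd, ZMod.χ₄_nat_one_mod_four (by omega)]
  obtain ⟨r, hr⟩ := exists_dvd_sq_add_of_jacobiSym_eq_one hP hJ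
  refine sum_three_sq_of_dvd_sq_add (D := (4 * j + 1 : ℕ)) (r := r) (by positivity) ?_ ?_
  · rw [← hPZ]; exact_mod_cast hP.pos
  · rwa [← hPZ]

/-- Here `D n - 1` is even for odd `D`, so it is taken to be `2 P`. The choice `D ≡ 3 (mod 8)` makes
`J(-2 | D) = 1`, whence `J(P | D) = J(-2 P | D) = J(1 | D) = 1`. -/
theorem sum_three_sq_of_mod_four_eq_one (t : ℕ) :
    ∃ u v w : ℤ, ((4 * t + 1 : ℕ) : ℤ) = u ^ 2 + v ^ 2 + w ^ 2 := by
  have hcop : (6 * t + 1).Coprime (4 * (4 * t + 1)) := by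
    refine Nat.Coprime.mul_right ?_ ?_
    · rw [show 6 * t + 1 = 2 * (3 * t) + 1 by ring, show 4 = 2 ^ 2 by rfl]
      exact Nat.Coprime.pow_right 2 (by simp)
    · refine Nat.isCoprime_iff_coprime.1 ⟨-2, 3, ?_⟩
      push_cast; ring
  obtain ⟨P, j, hP, hj⟩ := exists_prime_eq_add_mul (by omega) hcop
  have hPZ : 2 * (P : ℤ) = ((8 * j + 3 : ℕ) : ℤ) * (4 * t + 1 : ℕ) - 1 := by
    rw [hj]; push_cast; ring
  have hDodd : Odd (8 * j + 3) := Nat.odd_iff.2 (by omega)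
  have hP2 : P % 2 = 1 := by rw [hj, mul_assoc]; omega
  have hJ : jacobiSym (-((8 * j + 3 : ℕ) : ℤ)) P = 1 := by
    rw [jacobiSym_neg_eq_of_mod_four hDodd (by omega)]
    have h1 : jacobiSym (-2 * P) (8 * j + 3) = 1 := by
      rw [show -2 * (P : ℤ) = 1 + ((8 * j + 3 : ℕ) : ℤ) * -(4 * t + 1 : ℕ) by linarith,
        jacobiSym.mod_left' (a₂ := 1) (Int.add_mul_emod_self_left _ _ _), jacobiSym.one_left]
    rw [jacobiSym.mul_left, jacobiSym.at_neg_two hDodd, ZMod.χ₈'_nat_eq_if_mod_eight,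
      if_neg (by omega), if_pos (by omega), one_mul] at h1
    exact h1
  obtain ⟨r, hr⟩ := exists_dvd_sq_add_of_jacobiSym_eq_one hP hJ
  -- An odd root makes `s ^ 2 + D` even, so `2 P` divides it.
  obtain ⟨s, hs, hs2⟩ : ∃ s : ℤ, (P : ℤ) ∣ s ^ 2 + (8 * j + 3 : ℕ) ∧ Odd s := by
    rcases Int.even_or_odd r with h | h
    · refine ⟨r + P, ?_, h.add_odd (by exact_mod_cast Nat.odd_iff.2 hP2)⟩
      rw [show (r + P) ^ 2 + ((8 * j + 3 : ℕ) : ℤ) =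
        r ^ 2 + ((8 * j + 3 : ℕ) : ℤ) + P * (2 * r + P) by ring]
      exact hr.add (dvd_mul_right _ _)
    · exact ⟨r, hr, h⟩
  refine sum_three_sq_of_dvd_sq_add (D := (8 * j + 3 : ℕ)) (r := s) (by positivity) ?_ ?_
  · rw [← hPZ]; exact_mod_cast Nat.mul_pos two_pos hP.pos
  · rw [← hPZ]
    refine IsCoprime.mul_dvd ?_ ?_ hs
    · exact_mod_cast Nat.isCoprime_iff_coprime.2 (Nat.coprime_two_left.2 (Nat.odd_iff.2 hP2))
    · exact (hs2.pow.add_odd (by exact_mod_cast hDodd)).two_dvd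

theorem odd_eq_sum_four_sq_with_one_or_two (p : ℤ) (hpos : 0 < p) (hodd : Odd p) :
    ∃ a₁ a₂ a₃ a₄ : ℤ, (a₁ = 1 ∨ a₁ = 2) ∧ p = a₁ ^ 2 + a₂ ^ 2 + a₃ ^ 2 + a₄ ^ 2 := by
  rw [Int.odd_iff] at hodd
  -- `p = 1` stands apart because `p - 4` would be negative.
  obtain rfl | h | h : p = 1 ∨ (∃ t : ℕ, p = 4 * t + 3) ∨ ∃ t : ℕ, p = 4 * t + 5 := by
    by_cases h1 : p = 1
    · exact Or.inl h1
    · by_cases h3 : p % 4 = 3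
      · exact Or.inr (Or.inl ⟨(p / 4).toNat, by omega⟩)
      · exact Or.inr (Or.inr ⟨(p / 4 - 1).toNat, by omega⟩)
  · exact ⟨1, 0, 0, 0, Or.inl rfl, by norm_num⟩
  · obtain ⟨t, rfl⟩ := h
    obtain ⟨u, v, w, h⟩ := sum_three_sq_of_mod_four_eq_two t
    push_cast at h
    exact ⟨1, u, v, w, Or.inl rfl, by linarith⟩
  · obtain ⟨t, rfl⟩ := h
    obtain ⟨u, v, w, h⟩ := sum_three_sq_of_mod_four_eq_one t
    push_cast at h
    exact ⟨2, u, v, w, Or.inr rfl, by linarith⟩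

theorem mainTheorem7 (p : ℤ) (hpos : 0 < p) (hodd : Odd p) :
    ∃ a₁ a₂ a₃ a₄ : ℤ, (a₁ = 1 ∨ a₁ = 2) ∧ p = a₁ ^ 2 + a₂ ^ 2 + a₃ ^ 2 + a₄ ^ 2 ∧
      ∃ P : Quaternion ℝ, (P.re = a₁ ∧ P.imI = a₂ ∧ P.imJ = a₃ ∧ P.imK = a₄) ∧
        P ∈ lipschitzIntegers ∧ P ∈ hurwitzIntegers ∧
        Quaternion.normSq P = (p : ℝ) ∧ ∃ m : ℕ, P.re = 2 ^ m := by
  obtain ⟨a₁, a₂, a₃, a₄, ha, hp⟩ := odd_eq_sum_four_sq_with_one_or_two p hpos hodd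
  refine ⟨a₁, a₂, a₃, a₄, ha, hp, ⟨a₁, a₂, a₃, a₄⟩, ⟨rfl, rfl, rfl, rfl⟩,
    ⟨a₁, a₂, a₃, a₄, rfl, rfl, rfl, rfl⟩, Or.inl ⟨a₁, a₂, a₃, a₄, rfl, rfl, rfl, rfl⟩, ?_, ?_⟩
  · refine (Quaternion.normSq_def' _).trans ?_
    rw [hp]
    push_cast
    rfl
  · rcases ha with rfl | rfl
    · exact ⟨0, by simp⟩
    · exact ⟨1, by simp⟩
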